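/- Let $D$ be an integral domain with quotient field $K$. For a nonzero fractional ideal $A$ of $D$ put $A^{-1}=\{x\in K : xA\subseteq D\}$ and $A_v=(A^{-1})^{-1}$; put also $(0)_v=(0)$. An integral domain $D$ is called a $v$-domain if $(AA^{-1})^{-1}=D$ for every nonzero finitely generated ideal $A$ of $D$. Let $X$ be an indeterminate over $D$, for $f\in D[X]$ let $A_f$ denote the ideal of $D$ generated by the coefficients of $f$, and let $G=\{f\in D[X] : (A_f)_v=D\}$, which is a multiplicatively closed subset of $D[X]\setminus\{0\}$. Then $D$ is a $v$-domain if and only if the ring of fractions $D[X]_G$ is a $v$-domain. -/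

import Mathlib

open scoped nonZeroDivisors Polynomial

/-- The `v`-operation `A ↦ A_v = (A⁻¹)⁻¹` on fractional ideals of an integral domain `D` with
quotient field `K`. Here `A⁻¹ = {x ∈ K | x A ⊆ D}` for `A ≠ 0`, while `0⁻¹ = 0`, so `0_v = 0`. -/
noncomputable def vOp {D K : Type*} [CommRing D] [IsDomain D] [Field K] [Algebra D K]
    [IsFractionRing D K] (A : FractionalIdeal D⁰ K) : FractionalIdeal D⁰ K :=
  (A⁻¹)⁻¹

/-- An integral domain `D` is a `v`-domain if every nonzero finitely generated ideal `A` of `D`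
satisfies `(A A⁻¹)⁻¹ = D`. -/
def IsVDomain (D : Type*) [CommRing D] [IsDomain D] : Prop :=
  ∀ A : Ideal D, A ≠ ⊥ → A.FG →
    ((A : FractionalIdeal D⁰ (FractionRing D)) *
      (A : FractionalIdeal D⁰ (FractionRing D))⁻¹)⁻¹ = 1

/-- For an ideal, `A_v = D` says exactly that `A` is nonzero and that `x A ⊆ D` forces `x ∈ D`. -/
theorem vOp_coeIdeal_eq_one_iff {D K : Type*} [CommRing D] [IsDomain D] [Field K] [Algebra D K]
    [IsFractionRing D K] (A : Ideal D) :
    vOp (A : FractionalIdeal D⁰ K) = 1 ↔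
      A ≠ ⊥ ∧ ∀ x : K, (∀ a ∈ A, ∃ d : D, algebraMap D K d = x * algebraMap D K a) →
        ∃ d : D, algebraMap D K d = x := by
  have key : A ≠ ⊥ → ∀ x : K, x ∈ (A : FractionalIdeal D⁰ K)⁻¹ ↔
      ∀ a ∈ A, ∃ d : D, algebraMap D K d = x * algebraMap D K a := by
    intro hA x
    rw [FractionalIdeal.mem_inv_iff (by simpa using hA)]
    constructor
    · intro h a ha
      have := h _ ((FractionalIdeal.mem_coeIdeal D⁰).2 ⟨a, ha, rfl⟩)
      exact (FractionalIdeal.mem_one_iff D⁰).1 this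
    · intro h y hy
      obtain ⟨a, ha, rfl⟩ := (FractionalIdeal.mem_coeIdeal D⁰).1 hy
      exact (FractionalIdeal.mem_one_iff D⁰).2 (h a ha)
  constructor
  · intro h
    have hA : A ≠ ⊥ := by
      rintro rfl
      simp [vOp, FractionalIdeal.inv_zero'] at h
    refine ⟨hA, fun x hx => ?_⟩
    have hx' := (key hA x).2 hx
    have hI : (A : FractionalIdeal D⁰ K)⁻¹ ≠ 0 := by
      intro h0
      simp [vOp, h0, FractionalIdeal.inv_zero'] at h
    have h1 : (1 : K) ∈ vOp (A : FractionalIdeal D⁰ K) := by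
      rw [h]
      exact (FractionalIdeal.mem_one_iff D⁰).2 ⟨1, map_one _⟩
    have := (FractionalIdeal.mem_inv_iff hI).1 h1 x hx'
    rw [one_mul] at this
    exact (FractionalIdeal.mem_one_iff D⁰).1 this
  · rintro ⟨hA, h⟩
    have h1 : (A : FractionalIdeal D⁰ K)⁻¹ = 1 := by
      ext x
      rw [key hA, FractionalIdeal.mem_one_iff]
      refine ⟨h x, ?_⟩
      rintro ⟨d, rfl⟩ a _
      exact ⟨d * a, map_mul _ _ _⟩
    rw [vOp, h1, inv_one]

/-- The multiplicative set `G = {f ∈ D[X] | (A_f)_v = D}`, where `A_f` is the ideal of `D`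
generated by the coefficients of `f`. -/
noncomputable def contentVSet (D : Type*) [CommRing D] [IsDomain D] : Submonoid D[X] where
  carrier := {f | vOp (f.contentIdeal : FractionalIdeal D⁰ (FractionRing D)) = 1}
  one_mem' := by
    simp [vOp]
  mul_mem' := by
    intro f g hf hg
    simp only [Set.mem_ofPred_eq, vOp_coeIdeal_eq_one_iff] at hf hg ⊢
    obtain ⟨hf0, hf⟩ := hf
    obtain ⟨hg0, hg⟩ := hg
    rw [ne_eq, Polynomial.contentIdeal_eq_bot_iff] at hf0 hg0
    refine ⟨by simp [Polynomial.contentIdeal_eq_bot_iff, hf0, hg0], ?_⟩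
    obtain ⟨n, hn⟩ := Ideal.exists_pow_le_of_le_radical_of_fg
      (Polynomial.mul_contentIdeal_le_radical_contentIdeal_mul (p := f) (q := g))
      (Submodule.FG.mul f.contentIdeal_FG g.contentIdeal_FG)
    intro x hx
    replace hx := fun a ha => hx a (hn ha)
    clear hn
    induction n with
    | zero => simpa using hx 1 (by simp)
    | succ n ih =>
      refine ih fun a ha => hf _ fun b hb => hg _ fun c hc => ?_
      obtain ⟨d, hd⟩ := hx (a * (b * c))
        (by rw [pow_succ]; exact Ideal.mul_mem_mul ha (Ideal.mul_mem_mul hb hc))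
      exact ⟨d, by rw [hd, map_mul, map_mul]; ring⟩

theorem mem_contentVSet {D : Type*} [CommRing D] [IsDomain D] {f : D[X]} :
    f ∈ contentVSet D ↔
      vOp (f.contentIdeal : FractionalIdeal D⁰ (FractionRing D)) = 1 :=
  Iff.rfl

theorem contentVSet_le_nonZeroDivisors (D : Type*) [CommRing D] [IsDomain D] :
    contentVSet D ≤ D[X]⁰ := by
  intro f hf
  rw [mem_contentVSet, vOp_coeIdeal_eq_one_iff, ne_eq, Polynomial.contentIdeal_eq_bot_iff] at hf
  exact mem_nonZeroDivisors_of_ne_zero hf.1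

/-- `D[X]_G` is an integral domain. -/
instance instIsDomainLocalizationContentVSet (D : Type*) [CommRing D] [IsDomain D] :
    IsDomain (Localization (contentVSet D)) :=
  IsLocalization.isDomain_localization (contentVSet_le_nonZeroDivisors D)

/-! Everything takes place inside fields: `S` is the image of `D` in `K`, `T` the image of `D[X]_G`
in `L = K(X)`, and `E⁻¹` means `{y | yE ⊆ S}`, or `{y | yE ⊆ T}` in `L`. Being a `v`-domain says
that `x E E⁻¹ ⊆ S` forces `x ∈ S` for finite `E ≠ {0}`.

From `T` to `S` (`isVClosed_base`): for a finite set `E` of constants, any `y ∈ L` in `E⁻¹` has a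
multiple `y g`, `g ∈ G`, that is a polynomial with coefficients in the inverse of `E` in `K`. Hence
`x E E⁻¹ ⊆ S` passes to `T`, and `T ∩ K = S` because contents of elements of `G` have trivial
inverse.

From `S` to `T` (`isVClosed_localization`): as `K[X]` is principal, a finite subset of `L` can be
rescaled to generate the unit ideal of `K[X]`. Then (`mem_of_forall_span_eq_top`) the candidate `x`
equals `q / g` with `q ∈ K[X]` and `g ∈ G`. A `v`-domain is integrally closed, so Gauss's lemma
(`Subring.coeff_mul_coeff_mem`) separates products of polynomials into products of coefficients. It
puts each coefficient of `q` into `(E E⁻¹)⁻¹ = S`, where `E` is the set of coefficients of the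
generators. -/

/-- The fractional form of the `v`-domain property for a subring `S` of a field `L`: every nonzero
finitely generated fractional ideal is `v`-invertible. -/
def Subring.IsVClosed {L : Type*} [Field L] (S : Subring L) : Prop :=
  ∀ s : Set L, s.Finite → (∃ a ∈ s, a ≠ 0) → ∀ x : L,
    (∀ a ∈ s, ∀ y, (∀ b ∈ s, y * b ∈ S) → x * (a * y) ∈ S) → x ∈ S

theorem Subring.IsVClosed.map_equiv {L L' : Type*} [Field L] [Field L'] {S : Subring L}
    (hS : S.IsVClosed) (e : L ≃+* L') : (S.map (e : L →+* L')).IsVClosed := by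
  have mem : ∀ z : L', z ∈ S.map (e : L →+* L') ↔ e.symm z ∈ S := by
    intro z
    rw [Subring.mem_map]
    exact ⟨by rintro ⟨w, hw, rfl⟩; simpa using hw, fun h => ⟨_, h, by simp⟩⟩
  rintro s hs ⟨a, ha, ha0⟩ x hx
  rw [mem]
  refine hS (e.symm '' s) (hs.image _) ⟨_, ⟨a, ha, rfl⟩, by simpa using ha0⟩ _ ?_
  rintro _ ⟨a, ha, rfl⟩ y hy
  have := hx a ha (e y) fun b hb => by
    rw [mem]
    simpa using hy _ ⟨b, hb, rfl⟩
  rw [mem] at this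
  simpa using this

/-! ### The `v`-domain property in terms of finite subsets of a fraction field. -/

section VDomain

variable {R F : Type*} [CommRing R] [IsDomain R] [Field F] [Algebra R F] [IsFractionRing R F]

theorem exists_smul_mem_range_of_finite {s : Set F} (hs : s.Finite) :
    ∃ d : R, d ≠ 0 ∧ ∀ a ∈ s, algebraMap R F d * a ∈ (algebraMap R F).range := by
  obtain ⟨d, hd⟩ := IsLocalization.exist_integer_multiples_of_finset R⁰ hs.toFinset
  refine ⟨d, nonZeroDivisors.coe_ne_zero d, fun a ha => ?_⟩
  obtain ⟨r, hr⟩ := hd a (by simpa using ha)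
  exact ⟨r, by rw [hr, Algebra.smul_def]⟩

omit [IsDomain R] [IsFractionRing R F] in
theorem mem_one_iff_mem_range {x : F} :
    x ∈ (1 : FractionalIdeal R⁰ F) ↔ x ∈ (algebraMap R F).range := by
  rw [FractionalIdeal.mem_one_iff, RingHom.mem_range]

theorem mem_inv_span_iff {t : Set R} (ht : Ideal.span t ≠ ⊥) {x : F} :
    x ∈ (Ideal.span t : FractionalIdeal R⁰ F)⁻¹ ↔
      ∀ a ∈ t, x * algebraMap R F a ∈ (algebraMap R F).range := by
  rw [FractionalIdeal.mem_inv_iff (by simpa using ht)]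
  simp only [mem_one_iff_mem_range]
  constructor
  · exact fun h a ha => h _ (FractionalIdeal.mem_coeIdeal_of_mem _ (Ideal.subset_span ha))
  · intro h y hy
    obtain ⟨a, ha, rfl⟩ := (FractionalIdeal.mem_coeIdeal R⁰).1 hy
    induction ha using Submodule.span_induction with
    | mem a ha => exact h a ha
    | zero => simp
    | add a b ha hb iha ihb =>
      rw [map_add, mul_add]
      exact add_mem (iha (FractionalIdeal.mem_coeIdeal_of_mem _ ha))
        (ihb (FractionalIdeal.mem_coeIdeal_of_mem _ hb))
    | smul r a ha iha =>
      rw [smul_eq_mul, map_mul, mul_left_comm]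
      exact mul_mem ⟨r, rfl⟩ (iha (FractionalIdeal.mem_coeIdeal_of_mem _ ha))

theorem mul_inv_inv_span_eq_one_iff {t : Set R} (ht : Ideal.span t ≠ ⊥) :
    ((Ideal.span t : FractionalIdeal R⁰ F) * (Ideal.span t : FractionalIdeal R⁰ F)⁻¹)⁻¹ = 1 ↔
      ∀ x : F, (∀ a ∈ t, ∀ y, (∀ b ∈ t, y * algebraMap R F b ∈ (algebraMap R F).range) →
        x * (algebraMap R F a * y) ∈ (algebraMap R F).range) → x ∈ (algebraMap R F).range := by
  set A : FractionalIdeal R⁰ F := (Ideal.span t : FractionalIdeal R⁰ F) with hA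
  have hA0 : A ≠ 0 := by simpa [hA] using ht
  have hAinv : A * A⁻¹ ≠ 0 := by
    intro h
    -- `A` is an integral ideal, so `A ⊆ A A⁻¹`.
    have h1 : (1 : F) ∈ A⁻¹ := (mem_inv_span_iff ht).2 fun a _ => ⟨a, by simp⟩
    refine hA0 (FractionalIdeal.eq_zero_iff.2 fun a ha => ?_)
    have := FractionalIdeal.mul_mem_mul ha h1
    rwa [h, FractionalIdeal.mem_zero_iff, mul_one] at this
  have hmem : ∀ x : F, x ∈ (A * A⁻¹)⁻¹ ↔
      ∀ a ∈ t, ∀ y, (∀ b ∈ t, y * algebraMap R F b ∈ (algebraMap R F).range) →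
        x * (algebraMap R F a * y) ∈ (algebraMap R F).range := by
    intro x
    rw [FractionalIdeal.mem_inv_iff hAinv]
    simp only [mem_one_iff_mem_range]
    constructor
    · intro h a ha y hy
      exact h _ (FractionalIdeal.mul_mem_mul
        (FractionalIdeal.mem_coeIdeal_of_mem _ (Ideal.subset_span ha))
        ((mem_inv_span_iff ht).2 hy))
    · intro h z hz
      refine FractionalIdeal.mul_induction_on hz (fun a ha y hy => ?_) fun a b ha hb => ?_
      · have hxy : x * y ∈ A⁻¹ := by
          refine (mem_inv_span_iff ht).2 fun a ha => ?_
          have := h a ha y ((mem_inv_span_iff ht).1 hy)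
          rwa [mul_assoc, mul_comm y]
        have := (FractionalIdeal.mem_inv_iff hA0).1 hxy a ha
        rw [mem_one_iff_mem_range] at this
        rwa [mul_comm a, ← mul_assoc]
      · rw [mul_add]
        exact add_mem ha hb
  constructor
  · intro h x hx
    rw [← mem_one_iff_mem_range, ← h]
    exact (hmem x).2 hx
  · intro h
    ext x
    rw [hmem, mem_one_iff_mem_range]
    refine ⟨h x, fun hx a ha y hy => mul_mem hx ?_⟩
    rw [mul_comm]
    exact hy a ha

-- Scaling a finite set by a common denominator `d` divides its inverse by `d`, so `A A⁻¹` is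
-- unchanged and integral ideals suffice.
variable (R F) in
theorem isVClosed_range_iff_forall_ideal :
    (algebraMap R F).range.IsVClosed ↔ ∀ A : Ideal R, A ≠ ⊥ → A.FG →
      ((A : FractionalIdeal R⁰ F) * (A : FractionalIdeal R⁰ F)⁻¹)⁻¹ = 1 := by
  constructor
  · rintro h A hA ⟨t, rfl⟩
    rw [mul_inv_inv_span_eq_one_iff hA]
    intro x hx
    refine h (algebraMap R F '' t) (t.finite_toSet.image _) ?_ x ?_
    · by_contra! hc
      refine hA (Ideal.span_eq_bot.2 fun a ha => ?_)
      have := hc _ ⟨a, ha, rfl⟩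
      simpa using this
    · simpa only [Set.forall_mem_image] using hx
  · rintro h s hs ⟨a₀, ha₀, hne⟩ x hx
    obtain ⟨d, hd, hds⟩ := exists_smul_mem_range_of_finite (R := R) hs
    have hd' : algebraMap R F d ≠ 0 := by simpa using hd
    let t : Set R := algebraMap R F ⁻¹' ((algebraMap R F d * ·) '' s)
    have htfin : t.Finite := (hs.image _).preimage (IsFractionRing.injective R F).injOn
    have hts : ∀ a ∈ s, ∃ r ∈ t, algebraMap R F r = algebraMap R F d * a := by
      intro a ha
      obtain ⟨r, hr⟩ := hds a ha
      exact ⟨r, ⟨a, ha, hr.symm⟩, hr⟩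
    have htne : Ideal.span t ≠ ⊥ := by
      intro h0
      obtain ⟨r, hr, hra⟩ := hts a₀ ha₀
      rw [Ideal.span_eq_bot.1 h0 r hr, map_zero] at hra
      exact mul_ne_zero hd' hne hra.symm
    refine (mul_inv_inv_span_eq_one_iff htne).1
      (h _ htne ((Submodule.fg_def).2 ⟨t, htfin, rfl⟩)) x ?_
    rintro r ⟨a, ha, hr⟩ y hy
    have := hx a ha (algebraMap R F d * y) fun b hb => by
      obtain ⟨q, hq, hqb⟩ := hts b hb
      have := hy q hq
      rwa [hqb, ← mul_assoc, mul_comm y] at this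
    rw [← hr]
    convert this using 1
    ring

variable (R F) in
theorem isVDomain_iff_isVClosed_range :
    IsVDomain R ↔ (algebraMap R F).range.IsVClosed := by
  have key := isVClosed_range_iff_forall_ideal R (FractionRing R)
  change (∀ A : Ideal R, _) ↔ _
  rw [← key]
  let e : FractionRing R ≃ₐ[R] F := FractionRing.algEquiv R F
  have h1 : (algebraMap R (FractionRing R)).range.map (e.toRingEquiv : FractionRing R →+* F) =
      (algebraMap R F).range := by
    rw [RingHom.map_range]
    congr 1
    ext r
    exact e.commutes r
  have h2 : (algebraMap R F).range.map (e.symm.toRingEquiv : F →+* FractionRing R) =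
      (algebraMap R (FractionRing R)).range := by
    rw [RingHom.map_range]
    congr 1
    ext r
    exact e.symm.commutes r
  exact ⟨fun h => h1 ▸ h.map_equiv e.toRingEquiv, fun h => h2 ▸ h.map_equiv e.symm.toRingEquiv⟩

end VDomain

/-- If `x` is integral over `S`, then `I = S[x]` is finitely generated and `x I ⊆ I`. -/
theorem Subring.IsVClosed.isIntegrallyClosedIn {L : Type*} [Field L] {S : Subring L}
    (hS : S.IsVClosed) : IsIntegrallyClosedIn S L := by
  rw [isIntegrallyClosedIn_iff]
  refine ⟨Subtype.val_injective, fun {x} hx => ?_⟩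
  suffices x ∈ S from ⟨⟨x, this⟩, rfl⟩
  have hfg := hx.fg_adjoin_singleton
  obtain ⟨t, ht, hspan⟩ := Submodule.fg_def.1 hfg
  refine hS t ht ?_ x fun a ha y hy => ?_
  · by_contra! hc
    have : (1 : L) ∈ Subalgebra.toSubmodule (Algebra.adjoin S {x}) :=
      (Algebra.adjoin S {x}).one_mem
    rw [← hspan, Submodule.span_eq_bot.2 hc] at this
    simp at this
  -- Since `x I ⊆ I`, `x * a` is an `S`-combination of `t`, and `y` sends every such combination
  -- into `S`.
  · have hxa : x * a ∈ Submodule.span S t := by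
      have ha' : a ∈ Subalgebra.toSubmodule (Algebra.adjoin S {x}) :=
        hspan ▸ Submodule.subset_span ha
      rw [hspan]
      exact (Algebra.adjoin S {x}).mul_mem (Algebra.self_mem_adjoin_singleton S x) ha'
    rw [← mul_assoc]
    generalize x * a = z at hxa
    induction hxa using Submodule.span_induction with
    | mem b hb => rw [mul_comm]; exact hy b hb
    | zero => simp [S.zero_mem]
    | add b c _ _ ihb ihc => rw [add_mul]; exact add_mem ihb ihc
    | smul r b _ ihb =>
      rw [Subring.smul_def, smul_eq_mul, mul_assoc]
      exact mul_mem r.2 ihb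

/-! ### Gauss's lemma over integrally closed rings. -/

section Content

variable {K : Type*} [Field K]

/-- The least index at which the maximal value is attained; minimality is what isolates one dominant
term in a product. -/
theorem Valuation.exists_coeff_max {Γ : Type*} [LinearOrderedCommGroupWithZero Γ]
    (v : Valuation K Γ) {p : K[X]} (hp : p ≠ 0) :
    ∃ i, (∀ j, v (p.coeff j) ≤ v (p.coeff i)) ∧ (∀ j < i, v (p.coeff j) < v (p.coeff i)) ∧
      v (p.coeff i) ≠ 0 := by
  classical
  have hex : ∃ i, ∀ j, v (p.coeff j) ≤ v (p.coeff i) := by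
    obtain ⟨i, -, hi⟩ := p.support.exists_max_image (fun i => v (p.coeff i))
      (Polynomial.support_nonempty.2 hp)
    refine ⟨i, fun j => ?_⟩
    by_cases hj : j ∈ p.support
    · exact hi j hj
    · simp [Polynomial.notMem_support_iff.1 hj]
  have hmax := Nat.find_spec hex
  refine ⟨Nat.find hex, hmax, fun j hj => ?_, fun h0 => hp ?_⟩
  · have := Nat.find_min hex hj
    push Not at this
    obtain ⟨k, hk⟩ := this
    exact hk.trans_le (hmax k)
  · ext j
    have := hmax j
    rw [h0] at this
    simpa using this

/-- Gauss's lemma for a valuation ring. -/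
theorem ValuationSubring.coeff_mul_coeff_mem (V : ValuationSubring K) {p q : K[X]}
    (h : ∀ k, (p * q).coeff k ∈ V) (i j : ℕ) : p.coeff i * q.coeff j ∈ V := by
  rcases eq_or_ne p 0 with rfl | hp
  · simp [V.zero_mem]
  rcases eq_or_ne q 0 with rfl | hq
  · simp [V.zero_mem]
  obtain ⟨m, hm, hm', hm0⟩ := V.valuation.exists_coeff_max hp
  obtain ⟨n, hn, hn', hn0⟩ := V.valuation.exists_coeff_max hq
  have key : V.valuation ((p * q).coeff (m + n)) = V.valuation (p.coeff m * q.coeff n) := by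
    rw [Polynomial.coeff_mul, ← Finset.add_sum_erase _ _
      (show (m, n) ∈ Finset.HasAntidiagonal.antidiagonal (m + n) by simp)]
    refine Valuation.map_add_eq_of_lt_left _ (Valuation.map_sum_lt _ ?_ ?_)
    · simp only [map_mul]
      exact mul_ne_zero hm0 hn0
    · rintro ⟨a, b⟩ hab
      simp only [Finset.mem_erase, ne_eq, Prod.mk.injEq,
        Finset.HasAntidiagonal.mem_antidiagonal] at hab
      simp only [map_mul]
      -- Off `(m, n)` on the antidiagonal, either `a < m` or `b < n`, so one factor is strictly
      -- smaller than its maximum.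
      rcases lt_or_ge a m with ha | ha
      · exact mul_lt_mul_of_lt_of_le_of_nonneg_of_pos (hm' a ha) (hn b) zero_le
          (zero_lt_iff.2 hn0)
      · exact mul_lt_mul_of_le_of_lt_of_nonneg_of_pos (hm a)
          (hn' b (by grind)) zero_le (zero_lt_iff.2 hm0)
  have := (V.valuation_le_one_iff _).2 (h (m + n))
  rw [key, map_mul] at this
  rw [← V.valuation_le_one_iff, map_mul]
  exact (mul_le_mul' (hm i) (hn j)).trans this

/-- An integrally closed ring is the intersection of the valuation rings above it, which reduces the
claim to valuation rings. -/
theorem Subring.coeff_mul_coeff_mem {S : Subring K} [IsIntegrallyClosedIn S K] {p q : K[X]}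
    (h : ∀ k, (p * q).coeff k ∈ S) (i j : ℕ) : p.coeff i * q.coeff j ∈ S := by
  by_contra hc
  obtain ⟨V, hV, hc'⟩ := S.exists_le_valuationSubring_of_isIntegrallyClosedIn hc
  exact hc' (V.coeff_mul_coeff_mem (fun k => hV (h k)) i j)

end Content

/-! ### Passing between `S` and its localization `T`. -/

section

variable {K L : Type*} [Field K] [Field L] [Algebra K[X] L]

theorem Subring.coeff_mul_mem {S : Subring K} {p q : K[X]} (hp : ∀ k, p.coeff k ∈ S)
    (hq : ∀ k, q.coeff k ∈ S) (k : ℕ) : (p * q).coeff k ∈ S := by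
  rw [Polynomial.coeff_mul]
  exact sum_mem fun i _ => mul_mem (hp _) (hq _)

/-- `T` consists of the fractions `p / g` where `p` is a polynomial with coefficients in `S` and
`g` lies in a multiplicative set of such polynomials whose content has trivial inverse. -/
structure Subring.IsVLocalization (S : Subring K) (G : Submonoid K[X]) (T : Subring L) : Prop where
  coeff_mem : ∀ g ∈ G, ∀ k, g.coeff k ∈ S
  mem_of_mul_coeff_mem : ∀ g ∈ G, ∀ x : K, (∀ k, x * g.coeff k ∈ S) → x ∈ S
  mem_iff : ∀ u : L, u ∈ T ↔ ∃ g ∈ G, ∃ p : K[X], (∀ k, p.coeff k ∈ S) ∧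
    u * algebraMap K[X] L g = algebraMap K[X] L p

namespace Subring.IsVLocalization

variable {S : Subring K} {G : Submonoid K[X]} {T : Subring L}

theorem exists_common_denom (h : S.IsVLocalization G T) {t : Set L} (ht : t.Finite)
    (htT : ∀ u ∈ t, u ∈ T) :
    ∃ g ∈ G, ∀ u ∈ t, ∃ p : K[X], (∀ k, p.coeff k ∈ S) ∧
      u * algebraMap K[X] L g = algebraMap K[X] L p := by
  induction t, ht using Set.Finite.induction_on with
  | empty => exact ⟨1, one_mem _, by simp⟩
  | @insert a t _ _ ih =>
    obtain ⟨g, hg, hgt⟩ := ih fun u hu => htT u (Set.mem_insert_of_mem _ hu)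
    obtain ⟨g', hg', p', hp', hpa⟩ := (h.mem_iff a).1 (htT a (Set.mem_insert _ _))
    refine ⟨g * g', mul_mem hg hg', ?_⟩
    rintro u (rfl | hu)
    · refine ⟨g * p', coeff_mul_mem (h.coeff_mem g hg) hp', ?_⟩
      rw [map_mul, map_mul, ← hpa]
      ring
    · obtain ⟨p, hp, hpu⟩ := hgt u hu
      refine ⟨p * g', coeff_mul_mem hp (h.coeff_mem g' hg'), ?_⟩
      rw [map_mul, map_mul, ← hpu]
      ring

variable [IsFractionRing K[X] L]

theorem isVClosed_base (h : S.IsVLocalization G T) (hT : T.IsVClosed) : S.IsVClosed := by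
  have inj := IsFractionRing.injective K[X] L
  rintro s hs ⟨a₀, ha₀, hne⟩ x hx
  let φ := algebraMap K[X] L
  suffices hxT : φ (.C x) ∈ T by
    obtain ⟨g, hg, p, hp, hgp⟩ := (h.mem_iff _).1 hxT
    rw [← map_mul] at hgp
    have := inj hgp
    refine h.mem_of_mul_coeff_mem g hg x fun k => ?_
    rw [← Polynomial.coeff_C_mul, this]
    exact hp k
  refine hT ((fun a => φ (.C a)) '' s) (hs.image _) ⟨_, ⟨a₀, ha₀, rfl⟩, ?_⟩ _ ?_
  · simpa [φ] using hne
  rintro _ ⟨a, ha, rfl⟩ y hy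
  obtain ⟨g, hg, hgs⟩ := h.exists_common_denom (t := (y * ·) '' ((fun a => φ (.C a)) '' s))
    ((hs.image _).image _) (by simpa only [Set.forall_mem_image] using hy)
  -- Dividing by the nonzero constant `a₀` shows that `y g` itself lies in `K[X]`.
  obtain ⟨p₀, -, hp₀⟩ := hgs _ ⟨_, ⟨a₀, ha₀, rfl⟩, rfl⟩
  let q : K[X] := .C a₀⁻¹ * p₀
  have hq : y * φ g = φ q := by
    have h1 : φ (.C a₀⁻¹) * φ (.C a₀) = 1 := by
      rw [← map_mul, ← Polynomial.C_mul, inv_mul_cancel₀ hne, Polynomial.C_1, map_one]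
    calc y * φ g = φ (.C a₀⁻¹) * φ (.C a₀) * (y * φ g) := by rw [h1, one_mul]
      _ = φ (.C a₀⁻¹) * (y * φ (.C a₀) * φ g) := by ring
      _ = φ q := by rw [hp₀, ← map_mul]
  have hqs : ∀ b ∈ s, ∀ k, q.coeff k * b ∈ S := by
    intro b hb k
    obtain ⟨p, hp, hpb⟩ := hgs _ ⟨_, ⟨b, hb, rfl⟩, rfl⟩
    have : q * .C b = p := inj <| by
      rw [map_mul, ← hpb]
      change φ q * _ = _
      rw [← hq]
      ring
    rw [← Polynomial.coeff_mul_C, this]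
    exact hp k
  refine (h.mem_iff _).2 ⟨g, hg, .C (x * a) * q, fun k => ?_, ?_⟩
  · rw [Polynomial.coeff_C_mul, mul_assoc]
    exact hx a ha _ fun b hb => hqs b hb k
  · rw [map_mul, Polynomial.C_mul, map_mul]
    change _ = _ * φ q
    rw [← hq]
    ring

/-- The case of coprime generators. Coprimality makes `x` a fraction with numerator in `K[X]` and
denominator in `G`; the `v`-property of `S`, applied to the coefficients of `t`, then controls the
numerator. -/
theorem mem_of_forall_span_eq_top (h : S.IsVLocalization G T) (hS : S.IsVClosed)
    (hfrac : ∀ s : Set K, s.Finite → ∃ d : K, d ≠ 0 ∧ ∀ a ∈ s, d * a ∈ S)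
    {t : Set K[X]} (ht : t.Finite) (htop : Ideal.span t = ⊤) {x : L}
    (hx : ∀ f ∈ t, ∀ y, (∀ f' ∈ t, y * algebraMap K[X] L f' ∈ T) →
      x * (algebraMap K[X] L f * y) ∈ T) : x ∈ T := by
  have inj := IsFractionRing.injective K[X] L
  have hIC := hS.isIntegrallyClosedIn
  let φ := algebraMap K[X] L
  let E : Set K := ⋃ f ∈ t, (f.coeffs : Set K)
  have hEfin : E.Finite := ht.biUnion fun f _ => f.coeffs.finite_toSet
  have hE : ∀ z : K, (∀ e ∈ E, z * e ∈ S) → ∀ f ∈ t, ∀ k, z * f.coeff k ∈ S := by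
    intro z hz f hf k
    by_cases h0 : f.coeff k = 0
    · simp [h0]
    · exact hz _ (Set.mem_biUnion hf (Polynomial.coeff_mem_coeffs h0))
  -- A constant `z` in the inverse of `E` is also in the inverse of `t`.
  have hxE : ∀ z : K, (∀ e ∈ E, z * e ∈ S) → ∀ f ∈ t, x * (φ f * φ (.C z)) ∈ T := by
    intro z hz f hf
    refine hx f hf _ fun f' hf' => (h.mem_iff _).2 ⟨1, one_mem _, .C z * f', fun k => ?_, ?_⟩
    · rw [Polynomial.coeff_C_mul]
      exact hE z hz f' hf' k
    · rw [map_one, mul_one, map_mul]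
  obtain ⟨c, hc, hcE⟩ := hfrac E hEfin
  -- The elements `f` with `x c f ∈ K[X]_G` form an ideal containing `t`, hence containing `1`.
  have hxc : ∀ f ∈ Ideal.span t, ∃ g ∈ G, ∃ p : K[X], x * φ (.C c) * φ f * φ g = φ p := by
    intro f hf
    induction hf using Submodule.span_induction with
    | mem f hf =>
      obtain ⟨g, hg, p, -, hp⟩ := (h.mem_iff _).1 (hxE c hcE f hf)
      exact ⟨g, hg, p, by rw [← hp]; ring⟩
    | zero => exact ⟨1, one_mem _, 0, by simp⟩
    | add f₁ f₂ _ _ ih₁ ih₂ =>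
      obtain ⟨g₁, hg₁, p₁, hp₁⟩ := ih₁
      obtain ⟨g₂, hg₂, p₂, hp₂⟩ := ih₂
      refine ⟨g₁ * g₂, mul_mem hg₁ hg₂, p₁ * g₂ + p₂ * g₁, ?_⟩
      simp only [map_add, map_mul, ← hp₁, ← hp₂]
      ring
    | smul r f _ ih =>
      obtain ⟨g, hg, p, hp⟩ := ih
      refine ⟨g, hg, r * p, ?_⟩
      rw [smul_eq_mul, map_mul, map_mul, ← hp]
      ring
  obtain ⟨g, hg, p, hp⟩ := hxc 1 (htop ▸ Submodule.mem_top)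
  rw [map_one, mul_one] at hp
  let q : K[X] := .C c⁻¹ * p
  have hq : x * φ g = φ q := by
    have h1 : φ (.C c⁻¹) * φ (.C c) = 1 := by
      rw [← map_mul, ← Polynomial.C_mul, inv_mul_cancel₀ hc, Polynomial.C_1, map_one]
    calc x * φ g = φ (.C c⁻¹) * φ (.C c) * (x * φ g) := by rw [h1, one_mul]
      _ = φ (.C c⁻¹) * (x * φ (.C c) * φ g) := by ring
      _ = φ q := by rw [hp, ← map_mul]
  refine (h.mem_iff _).2 ⟨g, hg, q, fun k => ?_, hq⟩
  refine hS E hEfin ?_ _ ?_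
  · by_contra! hE0
    have : ∀ f ∈ t, f = 0 := by
      intro f hf
      by_contra hf0
      refine hf0 (Polynomial.leadingCoeff_eq_zero.1 (hE0 _ (Set.mem_biUnion hf ?_)))
      exact Polynomial.coeff_mem_coeffs (by simpa using hf0)
    rw [Ideal.span_eq_bot.2 this] at htop
    exact bot_ne_top htop
  · intro e he z hz
    obtain ⟨f, hf, hef⟩ := Set.mem_iUnion₂.1 he
    obtain ⟨j, -, rfl⟩ := Polynomial.mem_coeffs_iff.1 hef
    obtain ⟨g', hg', p', hp', hpf⟩ := (h.mem_iff _).1 (hxE z hz f hf)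
    have hprod : q * (f * .C z) * g' = p' * g := inj <| by
      simp only [map_mul, ← hpf]
      change φ q * _ * _ = _
      rw [← hq]
      ring
    -- Gauss's lemma first splits off `g'`, which is removed because its content has trivial
    -- inverse; a second use separates `q` from `f * C z`.
    have hqf : ∀ i, (q * (f * .C z)).coeff i ∈ S := fun i =>
      h.mem_of_mul_coeff_mem g' hg' _ fun j => coeff_mul_coeff_mem (fun k => by
        rw [hprod]
        exact coeff_mul_mem hp' (h.coeff_mem g hg) k) i j
    rw [← Polynomial.coeff_mul_C f j z]
    exact coeff_mul_coeff_mem hqf k j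

theorem isVClosed_localization (h : S.IsVLocalization G T) (hS : S.IsVClosed)
    (hfrac : ∀ s : Set K, s.Finite → ∃ d : K, d ≠ 0 ∧ ∀ a ∈ s, d * a ∈ S) : T.IsVClosed := by
  rintro s hs ⟨a₀, ha₀, hne⟩ x hx
  have inj := IsFractionRing.injective K[X] L
  let φ := algebraMap K[X] L
  obtain ⟨d, hd, hds⟩ := exists_smul_mem_range_of_finite (R := K[X]) hs
  have hd' : φ d ≠ 0 := by simpa [φ] using hd
  let t : Set K[X] := φ ⁻¹' ((φ d * ·) '' s)
  have htfin : t.Finite := (hs.image _).preimage inj.injOn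
  -- `g` is a gcd of `t`; the quotients `t'` then generate the unit ideal.
  obtain ⟨g, hg⟩ := (inferInstance : (Ideal.span t).IsPrincipal)
  have hgdvd : ∀ f ∈ t, g ∣ f := fun f hf =>
    Ideal.mem_span_singleton.1 (hg.le (Ideal.subset_span hf))
  have hlift : ∀ a ∈ s, ∃ f, g * f ∈ t ∧ φ g * φ f = φ d * a := by
    intro a ha
    obtain ⟨r, hr⟩ := hds a ha
    have hrt : r ∈ t := ⟨a, ha, hr.symm⟩
    obtain ⟨f, rfl⟩ := hgdvd r hrt
    exact ⟨f, hrt, by rw [← map_mul]; exact hr⟩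
  have hg0 : g ≠ 0 := by
    rintro rfl
    obtain ⟨f, -, hf⟩ := hlift a₀ ha₀
    rw [map_zero, zero_mul] at hf
    exact mul_ne_zero hd' hne hf.symm
  have hg' : φ g ≠ 0 := by simpa [φ] using hg0
  let t' : Set K[X] := (g * ·) ⁻¹' t
  have htfin' : t'.Finite := htfin.preimage (mul_right_injective₀ hg0).injOn
  have htop : Ideal.span t' = ⊤ := by
    have key : ∀ f ∈ Ideal.span t, ∃ e ∈ Ideal.span t', f = g * e := by
      intro f hf
      induction hf using Submodule.span_induction with
      | mem f hf =>
        obtain ⟨e, rfl⟩ := hgdvd f hf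
        exact ⟨e, Ideal.subset_span hf, rfl⟩
      | zero => exact ⟨0, zero_mem _, by simp⟩
      | add f₁ f₂ _ _ ih₁ ih₂ =>
        obtain ⟨e₁, he₁, rfl⟩ := ih₁
        obtain ⟨e₂, he₂, rfl⟩ := ih₂
        exact ⟨e₁ + e₂, add_mem he₁ he₂, by ring⟩
      | smul r f _ ih =>
        obtain ⟨e, he, rfl⟩ := ih
        exact ⟨r * e, Ideal.mul_mem_left _ _ he, by rw [smul_eq_mul]; ring⟩
    obtain ⟨e, he, hge⟩ := key g (hg.ge (Ideal.mem_span_singleton_self g))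
    rw [Ideal.eq_top_iff_one]
    rwa [mul_eq_left₀ hg0 |>.1 hge.symm] at he
  refine h.mem_of_forall_span_eq_top hS hfrac htfin' htop fun f hf y hy => ?_
  obtain ⟨a, ha, haf⟩ := hf
  have haf' : φ d * a = φ g * φ f := by rw [← map_mul]; exact haf
  -- The sets `s` and `t'` differ by the factor `d / g`, so their inverses differ by its reciprocal
  -- and the products `a * y` agree.
  have := hx a ha (φ d / φ g * y) fun b hb => by
    obtain ⟨f', hf', hfb⟩ := hlift b hb
    convert hy f' hf' using 1
    change _ = y * φ f'
    field_simp
    linear_combination -y * hfb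
  convert this using 2
  change φ f * y = _
  field_simp
  linear_combination -y * haf'

end Subring.IsVLocalization

end

/-! ### Realizing `D[X]_G` inside `K(X)`. -/

section

variable {D : Type*} [CommRing D] [IsDomain D] {R K L : Type*} [CommRing R] [IsDomain R]
  [Algebra D[X] R] [IsLocalization (contentVSet D) R] [Field K] [Algebra D K] [IsFractionRing D K]
  [Field L] [Algebra K[X] L] [IsFractionRing K[X] L] [Algebra D[X] L]

omit [IsDomain D] [IsFractionRing D K] in
theorem coeff_mem_range_iff {p : K[X]} :
    (∀ k, p.coeff k ∈ (algebraMap D K).range) ↔ ∃ f : D[X], f.map (algebraMap D K) = p := by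
  have := Polynomial.lifts_iff_coeff_lifts (f := algebraMap D K) p
  rw [Polynomial.mem_lifts] at this
  exact this.symm

/-- A common denominator in `D` for the coefficients of `p` and `q` turns `p / q` into a quotient of
polynomials over `D`. -/
theorem isFractionRing_polynomial
    (hL : ∀ f : D[X], algebraMap D[X] L f = algebraMap K[X] L (f.map (algebraMap D K))) :
    IsFractionRing D[X] L := by
  have hinj : Function.Injective (algebraMap D[X] L) := by
    intro f g hfg
    rw [hL, hL] at hfg
    exact Polynomial.map_injective _ (IsFractionRing.injective D K)
      (IsFractionRing.injective K[X] L hfg)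
  have := (faithfulSMul_iff_algebraMap_injective D[X] L).2 hinj
  refine IsFractionRing.of_field D[X] L fun z => ?_
  obtain ⟨p, q, hq, rfl⟩ := IsFractionRing.div_surjective K[X] z
  obtain ⟨d, hd, hds⟩ := exists_smul_mem_range_of_finite (R := D)
    (s := (p.coeffs ∪ q.coeffs : Set K))
    (p.coeffs.finite_toSet.union q.coeffs.finite_toSet)
  have hmem : ∀ r : K[X], (r.coeffs : Set K) ⊆ p.coeffs ∪ q.coeffs →
      ∃ f : D[X], f.map (algebraMap D K) = .C (algebraMap D K d) * r := by
    intro r hr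
    rw [← coeff_mem_range_iff]
    intro k
    rw [Polynomial.coeff_C_mul]
    by_cases h0 : r.coeff k = 0
    · simp [h0]
    · exact hds _ (hr (Polynomial.coeff_mem_coeffs h0))
  obtain ⟨f, hf⟩ := hmem p Set.subset_union_left
  obtain ⟨g, hg⟩ := hmem q Set.subset_union_right
  refine ⟨f, g, ?_⟩
  have hd' : algebraMap K[X] L (.C (algebraMap D K d)) ≠ 0 := by simpa using hd
  rw [hL, hL, hf, hg, map_mul, map_mul, mul_div_mul_left _ _ hd']

/-- Membership in `G` is used only in this form: the inverse of the content ideal is `D`, tested on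
coefficients. -/
theorem mem_range_of_mem_contentVSet {g : D[X]} (hg : g ∈ contentVSet D) {x : FractionRing D}
    (hx : ∀ k, x * algebraMap D (FractionRing D) (g.coeff k) ∈
      (algebraMap D (FractionRing D)).range) :
    x ∈ (algebraMap D (FractionRing D)).range := by
  rw [mem_contentVSet, vOp_coeIdeal_eq_one_iff] at hg
  refine hg.2 x fun a ha => ?_
  have hg0 := hg.1
  rw [Polynomial.contentIdeal_def] at hg0 ha
  have hinv : x ∈ ((Ideal.span (g.coeffs : Set D) : Ideal D) : FractionalIdeal D⁰ (FractionRing D))⁻¹ := by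
    refine (mem_inv_span_iff hg0).2 fun c hc => ?_
    obtain ⟨k, -, rfl⟩ := Polynomial.mem_coeffs_iff.1 hc
    exact hx k
  exact (FractionalIdeal.mem_one_iff D⁰).1 ((FractionalIdeal.mem_inv_iff (by simpa using hg0)).1
    hinv _ (FractionalIdeal.mem_coeIdeal_of_mem _ ha))

omit [IsDomain R] in
theorem isVLocalization_range [Algebra (FractionRing D)[X] L]
    [IsFractionRing (FractionRing D)[X] L] [Algebra R L] [IsScalarTower D[X] R L]
    (hL : ∀ f : D[X], algebraMap D[X] L f = algebraMap (FractionRing D)[X] L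
      (f.map (algebraMap D (FractionRing D)))) :
    (algebraMap D (FractionRing D)).range.IsVLocalization
      ((contentVSet D).map (Polynomial.mapRingHom (algebraMap D (FractionRing D)))) (algebraMap R L).range where
  coeff_mem := by
    rintro _ ⟨g, -, rfl⟩
    exact coeff_mem_range_iff.2 ⟨g, rfl⟩
  mem_of_mul_coeff_mem := by
    rintro _ ⟨g, hg, rfl⟩ x hx
    exact mem_range_of_mem_contentVSet hg (by simpa using hx)
  mem_iff := by
    intro u
    constructor
    · rintro ⟨r, rfl⟩
      obtain ⟨⟨f, g⟩, hfg⟩ := IsLocalization.surj (contentVSet D) r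
      refine ⟨_, ⟨g, g.2, rfl⟩, _, coeff_mem_range_iff.2 ⟨f, rfl⟩, ?_⟩
      rw [Polynomial.coe_mapRingHom, ← hL, ← hL, IsScalarTower.algebraMap_apply D[X] R L,
        IsScalarTower.algebraMap_apply D[X] R L, ← hfg, map_mul]
    · rintro ⟨_, ⟨g, hg, rfl⟩, p, hp, hup⟩
      obtain ⟨f, rfl⟩ := coeff_mem_range_iff.1 hp
      rw [Polynomial.coe_mapRingHom, ← hL, ← hL] at hup
      have hunit := (IsLocalization.map_units R (⟨g, hg⟩ : contentVSet D)).map (algebraMap R L)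
      rw [← IsScalarTower.algebraMap_apply D[X] R L] at hunit
      refine ⟨IsLocalization.mk' R f ⟨g, hg⟩, hunit.mul_left_injective ?_⟩
      change _ * algebraMap D[X] L g = u * algebraMap D[X] L g
      rw [hup, IsScalarTower.algebraMap_apply D[X] R L, IsScalarTower.algebraMap_apply D[X] R L,
        ← map_mul, IsLocalization.mk'_spec]

variable (D R) in
theorem isVDomain_iff_isVDomain_of_isLocalization : IsVDomain D ↔ IsVDomain R := by
  let K := FractionRing D
  let L := FractionRing K[X]
  let : Algebra D[X] L :=
    ((algebraMap K[X] L).comp (Polynomial.mapRingHom (algebraMap D K))).toAlgebra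
  have hL : ∀ f : D[X], algebraMap D[X] L f = algebraMap K[X] L (f.map (algebraMap D K)) :=
    fun _ => rfl
  have : IsFractionRing D[X] L := isFractionRing_polynomial hL
  have hunits : ∀ g : contentVSet D, IsUnit (algebraMap D[X] L g) := fun g =>
    IsLocalization.map_units L
      (⟨g, contentVSet_le_nonZeroDivisors D g.2⟩ : D[X]⁰)
  let : Algebra R L := (IsLocalization.lift hunits : R →+* L).toAlgebra
  have : IsScalarTower D[X] R L :=
    .of_algebraMap_eq fun f => (IsLocalization.lift_eq hunits f).symm
  have : IsFractionRing R L :=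
    IsFractionRing.isFractionRing_of_isDomain_of_isLocalization (contentVSet D) R L
  have h := isVLocalization_range (R := R) hL
  rw [isVDomain_iff_isVClosed_range D K, isVDomain_iff_isVClosed_range R L]
  refine ⟨fun hD => h.isVClosed_localization hD fun s hs => ?_, h.isVClosed_base⟩
  obtain ⟨d, hd, hds⟩ := exists_smul_mem_range_of_finite (R := D) hs
  exact ⟨algebraMap D K d, (map_ne_zero_iff _ (IsFractionRing.injective D K)).2 hd, hds⟩

end

theorem corollaryM (D : Type*) [CommRing D] [IsDomain D] :
    IsVDomain D ↔ IsVDomain (Localization (contentVSet D)) := by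
  exact isVDomain_iff_isVDomain_of_isLocalization D (Localization (contentVSet D))
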